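/- Let $G=(V,E)$ be a finite graph, possibly with loops or multiple edges, with nonnegative real edge weights $\lambda=\{\lambda_e\}_{e\in E}$. For $H\subseteq E$ and $v\in V$ let $\deg(H,v)$ be the degree of $v$ in the spanning subgraph $(V,H)$ (loops count twice), and let $\deg(G,v)=\deg(E,v)$. Let $f,g:V\to\mathbb{N}$ satisfy $f(v)\le g(v)\le f(v)+2$ for all $v\in V$, and let $u^{(v)}_k=1$ if $f(v)\le k\le g(v)$ and $u^{(v)}_k=0$ otherwise. Define the key polynomials $$K_v(z)=\sum_{j=0}^{d}\binom{d}{j}u^{(v)}_j z^j,\qquad d=\deg(G,v)\quad(v\in V),$$ and, in variables $x=\{x_v\}_{v\in V}$, $$Z(G,\lambda,u;x)=\sum_{H\subseteq E}\ \prod_{e\in H}\lambda_e\ \prod_{v\in V}u^{(v)}_{\deg(H,v)}\,x_v^{\deg(H,v)}.$$ For $0<\theta\le\pi$ let $S[\theta]=\{z\in\mathbb{C}: z\ne 0,\ |\arg z|<\theta\}$, where $-\pi<\arg z\le\pi$. A complex polynomial is called $S[\theta]$-nonvanishing if it is identically zero or it is nonzero whenever all its variables take values in $S[\theta]$. Then: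 1. each key polynomial $K_v(z)$, $v\in V$, is $S[2\pi/3]$-nonvanishing; 2. $Z(G,\lambda,u;x)$ is $S[\pi/6]$-nonvanishing; 3. the univariate specialization $Z(G,\lambda,u;y^{1/2}\mathbf{1})$, obtained by setting $x_v=y^{1/2}$ for every $v\in V$, is a polynomial in $y$ (independent of the choice of square root), and it is $S[\pi/3]$-nonvanishing. -/

import Mathlib

open scoped Graph

noncomputable section

namespace HeilmannLieb

/-- The open sector `S[θ]` centred on the positive real axis
(`Complex.arg` takes values in `(-π, π]`). -/
def sector (θ : ℝ) : Set ℂ := {z | z ≠ 0 ∧ |Complex.arg z| < θ}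

/-- A multivariate polynomial is `A`-nonvanishing if it is identically zero, or it has no zero
all of whose coordinates lie in `A`. -/
def MvNonvanishing {σ : Type*} (A : Set ℂ) (F : MvPolynomial σ ℂ) : Prop :=
  F = 0 ∨ ∀ z : σ → ℂ, (∀ v, z v ∈ A) → MvPolynomial.eval z F ≠ 0

/-- The same notion for a polynomial in one variable. -/
def Nonvanishing (A : Set ℂ) (F : Polynomial ℂ) : Prop :=
  F = 0 ∨ ∀ z ∈ A, Polynomial.eval z F ≠ 0

variable {α β : Type*} (G : Graph α β)

open Classical in
/-- The degree of the vertex `v` in the spanning subgraph with edge set `H`;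
a loop at `v` is counted twice. -/
def deg (H : Finset E(G)) (v : V(G)) : ℕ :=
  (H.filter fun e => G.Inc e v).card + (H.filter fun e => G.IsLoopAt e v).card

variable [Fintype E(G)]

/-- The degree of `v` in the whole graph. -/
def degG (v : V(G)) : ℕ := deg G Finset.univ v

/-- The key polynomial of the vertex `v`: `K_v(z) = ∑_{j=0}^d (d choose j) u_j^{(v)} z^j`,
with `d = deg(G,v)`. -/
def key (u : V(G) → ℕ → ℂ) (v : V(G)) : Polynomial ℂ :=
  ∑ j ∈ Finset.range (degG G v + 1),
    Polynomial.C (((degG G v).choose j : ℂ) * u v j) * Polynomial.X ^ j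

/-- `Z(G,λ,u;x) = ∑_{H ⊆ E} λ^H u_{deg H} x^{deg H}`. Only the activities `u v k` with
`k ≤ deg(G,v)` occur in it. -/
def Z [Fintype V(G)] (lam : E(G) → ℂ) (u : V(G) → ℕ → ℂ) : MvPolynomial V(G) ℂ :=
  ∑ H : Finset E(G),
    MvPolynomial.C ((∏ e ∈ H, lam e) * ∏ v : V(G), u v (deg G H v)) *
      ∏ v : V(G), MvPolynomial.X v ^ deg G H v

/-- The activities `u_k^{(v)} = 1` if `f(v) ≤ k ≤ g(v)`, and `0` otherwise. -/
def intervalActivity {V : Type*} (f g : V → ℕ) (v : V) (k : ℕ) : ℂ :=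
  if f v ≤ k ∧ k ≤ g v then 1 else 0

end HeilmannLieb

end

/-!
With all activities equal to `1` the partition function is the product over the edges `e = ab` of
`1 + λ_e x_a x_b`, which has no zero when all `x_v` lie in the open right half-plane.
The activities are then switched on one vertex at a time: as a function of `x_v`, replacing each
monomial `x_v ^ k` by `u_k x_v ^ k` is a Szegő composition with `K_v`, and by Grace's theorem the
result is nonzero as soon as `x_v` times the closed right half-plane avoids the zeros of `K_v`.
If `K_v` is zero-free on `S[θ]` this holds for `x_v ∈ S[θ - π/2]`. Grace's theorem needs `K_v` to
have exact degree `d` and `K_v(0) ≠ 0`; a perturbation and Hurwitz's theorem remove both conditions.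

For activities supported on at most three consecutive degrees `K_v` is a power of `z` times a real
quadratic `a + b z + c z ^ 2`, and `a c ≤ b ^ 2` by log-concavity of the binomial coefficients,
which gives `θ = 2π/3`. Since the degrees of `(V, H)` sum to `2 |H|`, setting `x_v = y^{1/2}` yields
a polynomial in `y`, and the square root doubles the opening angle.
-/

namespace HeilmannLieb

open Polynomial Filter Topology

section Grace

lemma norm_conj_add_le_norm_sub_iff {z r : ℂ} (hz : 0 < z.re) :
    ‖starRingEnd ℂ z + r‖ ≤ ‖z - r‖ ↔ r.re ≤ 0 := by
  have hdiff : ‖z - r‖ ^ 2 - ‖starRingEnd ℂ z + r‖ ^ 2 = -(4 * z.re) * r.re := by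
    simp only [← Complex.normSq_eq_norm_sq, Complex.normSq_apply, Complex.sub_re, Complex.sub_im,
      Complex.add_re, Complex.add_im, Complex.conj_re, Complex.conj_im]
    ring
  rw [← sq_le_sq₀ (norm_nonneg _) (norm_nonneg _), ← sub_nonneg, hdiff]
  constructor <;> intro h <;> nlinarith

/-- Inversion centred at `z` maps the closed left half-plane onto a disc with `0` on its
boundary. -/
lemma norm_inv_sub_sub_le_iff {z r : ℂ} (hz : 0 < z.re) (hzr : z ≠ r) :
    ‖(z - r)⁻¹ - (2 * z.re : ℂ)⁻¹‖ ≤ (2 * z.re)⁻¹ ↔ r.re ≤ 0 := by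
  have hx : (2 * z.re : ℂ) ≠ 0 := by exact_mod_cast (by positivity : (2 * z.re) ≠ 0)
  have hsub : z - r ≠ 0 := sub_ne_zero.2 hzr
  have hinv : (z - r)⁻¹ - (2 * z.re : ℂ)⁻¹ =
      (2 * z.re : ℂ)⁻¹ * ((starRingEnd ℂ z + r) / (z - r)) := by
    rw [inv_sub_inv hsub hx, eq_sub_of_add_eq' (Complex.add_conj z)]
    push_cast
    field_simp
    ring
  have hnorm : ‖(2 * z.re : ℂ)⁻¹‖ = (2 * z.re)⁻¹ := by
    rw [norm_inv, ← Complex.ofReal_ofNat, ← Complex.ofReal_mul,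
      Complex.norm_of_nonneg (by positivity)]
  rw [hinv, norm_mul, hnorm, mul_le_iff_le_one_right (by positivity), norm_div,
    div_le_one (norm_pos_iff.2 hsub), norm_conj_add_le_norm_sub_iff hz]

lemma norm_multiset_sum_sub_le {s : Multiset ℂ} {c : ℂ} {ρ : ℝ}
    (hs : ∀ w ∈ s, ‖w - c‖ ≤ ρ) : ‖s.sum - s.card * c‖ ≤ s.card * ρ := by
  induction s using Multiset.induction_on with
  | empty => simp
  | cons w s ih =>
    rw [Multiset.forall_mem_cons] at hs
    calc ‖(w ::ₘ s).sum - (w ::ₘ s).card * c‖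
        = ‖(w - c) + (s.sum - s.card * c)‖ := by
          rw [Multiset.sum_cons, Multiset.card_cons]
          push_cast
          ring_nf
      _ ≤ ρ + s.card * ρ := norm_add_le_of_le hs.1 (ih hs.2)
      _ = (w ::ₘ s).card * ρ := by
          rw [Multiset.card_cons]
          push_cast
          ring

lemma norm_logDeriv_sub_le {p : ℂ[X]} {n : ℕ} (hn : p.natDegree ≤ n)
    (hp : ∀ z : ℂ, 0 < z.re → p.eval z ≠ 0) {z : ℂ} (hz : 0 < z.re) :
    ‖p.derivative.eval z / p.eval z - n * (2 * z.re : ℂ)⁻¹‖ ≤ n * (2 * z.re)⁻¹ := by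
  have hpz := hp z hz
  set ρ : ℝ := (2 * z.re)⁻¹ with hρ
  have hcast : (2 * z.re : ℂ)⁻¹ = (ρ : ℂ) := by rw [hρ]; push_cast; rfl
  obtain ⟨k, hk⟩ := Nat.exists_eq_add_of_le ((card_roots' p).trans hn)
  have hroots : ∀ w ∈ p.roots.map fun r => 1 / (z - r), ‖w - ρ‖ ≤ ρ := by
    simp only [Multiset.mem_map, forall_exists_index, and_imp, forall_apply_eq_imp_iff₂]
    intro r hr
    rw [one_div, ← hcast, norm_inv_sub_sub_le_iff hz]
    · by_contra! hr0
      exact hp r hr0 (isRoot_of_mem_roots hr)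
    · rintro rfl
      exact hpz (isRoot_of_mem_roots hr)
  have hsum := norm_multiset_sum_sub_le hroots
  rw [Multiset.card_map, ← (IsAlgClosed.splits p).eval_derivative_div_eval_of_ne_zero hpz] at hsum
  have hρ0 : 0 ≤ ρ := by positivity
  have hrest : ‖(k * ρ : ℂ)‖ = k * ρ := by
    rw [norm_mul, Complex.norm_natCast, Complex.norm_of_nonneg hρ0]
  calc ‖p.derivative.eval z / p.eval z - n * (2 * z.re : ℂ)⁻¹‖
      = ‖(p.derivative.eval z / p.eval z - p.roots.card * ρ) - k * ρ‖ := by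
        rw [hcast, hk]
        push_cast
        ring_nf
    _ ≤ p.roots.card * ρ + k * ρ := norm_sub_le_of_le hsum hrest.le
    _ = n * ρ := by rw [hk]; push_cast; ring

theorem laguerre_rightHalfPlane {p : ℂ[X]} {n : ℕ} (hn : p.natDegree ≤ n) (hn0 : n ≠ 0)
    (hp : ∀ z : ℂ, 0 < z.re → p.eval z ≠ 0) {z ξ : ℂ} (hz : 0 < z.re) (hξ : 0 < ξ.re) :
    n * p.eval z + (ξ - z) * p.derivative.eval z ≠ 0 := by
  intro h
  have hpz := hp z hz
  have hn' : (n : ℂ) ≠ 0 := Nat.cast_ne_zero.2 hn0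
  have hzξ : z ≠ ξ := by
    rintro rfl
    simp [hn', hpz] at h
  have hlog : p.derivative.eval z / p.eval z = n * (z - ξ)⁻¹ := by
    have hsub := sub_ne_zero.2 hzξ
    field_simp
    linear_combination -h
  have hdisc := norm_logDeriv_sub_le hn hp hz
  rw [hlog, ← mul_sub, norm_mul, Complex.norm_natCast,
    mul_le_mul_iff_right₀ (by positivity), norm_inv_sub_sub_le_iff hz hzξ] at hdisc
  exact hξ.not_ge hdisc

/-- The polynomial `∑_{j ≤ d} (d choose j) b_j X^j` with activities `b`; the key polynomial of a
vertex of degree `d` has this form. -/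
noncomputable def binomialPoly (d : ℕ) (b : ℕ → ℂ) : ℂ[X] :=
  ∑ j ∈ Finset.range (d + 1), C ((d.choose j : ℂ) * b j) * X ^ j

lemma coeff_binomialPoly (d : ℕ) (b : ℕ → ℂ) (j : ℕ) :
    (binomialPoly d b).coeff j = (d.choose j : ℂ) * b j := by
  simp only [binomialPoly, finsetSum_coeff, coeff_C_mul_X_pow, Finset.sum_ite_eq,
    Finset.mem_range, Nat.lt_succ_iff, ite_eq_left_iff, not_le]
  intro hj
  rw [Nat.choose_eq_zero_of_lt hj, Nat.cast_zero, zero_mul]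

lemma natDegree_binomialPoly_le (d : ℕ) (b : ℕ → ℂ) : (binomialPoly d b).natDegree ≤ d := by
  rw [natDegree_le_iff_coeff_eq_zero]
  intro j hj
  rw [coeff_binomialPoly, Nat.choose_eq_zero_of_lt hj, Nat.cast_zero, zero_mul]

lemma binomialPoly_coeff_div_choose {d : ℕ} {p : ℂ[X]} (hp : p.natDegree ≤ d) :
    binomialPoly d (fun j => p.coeff j / d.choose j) = p := by
  ext j
  rw [coeff_binomialPoly]
  rcases le_or_gt j d with hj | hj
  · exact mul_div_cancel₀ _ (Nat.cast_ne_zero.2 (Nat.choose_pos hj).ne')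
  · rw [coeff_eq_zero_of_natDegree_lt (hp.trans_lt hj), zero_div, mul_zero]

lemma binomialPoly_eq_zero_iff {d : ℕ} {b : ℕ → ℂ} :
    binomialPoly d b = 0 ↔ ∀ j ≤ d, b j = 0 := by
  simp only [Polynomial.ext_iff, coeff_binomialPoly, coeff_zero, mul_eq_zero, Nat.cast_eq_zero,
    Nat.choose_eq_zero_iff]
  exact forall_congr' fun j => by rw [or_iff_not_imp_left, not_lt]

lemma binomialPoly_succ (d : ℕ) (b : ℕ → ℂ) :
    binomialPoly (d + 1) b = binomialPoly d b + X * binomialPoly d fun j => b (j + 1) := by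
  ext j
  rcases j with _ | j
  · simp [coeff_binomialPoly]
  · simp only [coeff_add, coeff_X_mul, coeff_binomialPoly, Nat.choose_succ_succ, Nat.cast_add]
    ring

lemma derivative_binomialPoly_succ (d : ℕ) (b : ℕ → ℂ) :
    derivative (binomialPoly (d + 1) b) = C (d + 1 : ℂ) * binomialPoly d fun j => b (j + 1) := by
  ext j
  have hchoose : (d + 1 : ℂ) * d.choose j = (d + 1).choose (j + 1) * (j + 1) :=
    mod_cast Nat.add_one_mul_choose_eq d j
  rw [coeff_derivative, coeff_C_mul, coeff_binomialPoly, coeff_binomialPoly]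
  linear_combination -b (j + 1) * hchoose

lemma binomialPoly_sub_mul (d : ℕ) (b c : ℕ → ℂ) (w : ℂ) :
    binomialPoly d (fun j => b j - w * c j) = binomialPoly d b - C w * binomialPoly d c := by
  ext j
  simp only [coeff_sub, coeff_C_mul, coeff_binomialPoly]
  ring

lemma eval_binomialPoly_shift_ne_zero {d : ℕ} {b : ℕ → ℂ}
    (hb : ∀ z : ℂ, 0 < z.re → (binomialPoly (d + 1) b).eval z ≠ 0) {w : ℂ} (hw : w.re < 0)
    {z : ℂ} (hz : 0 < z.re) :
    (binomialPoly d fun j => b (j + 1) - w * b j).eval z ≠ 0 := by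
  have hw0 : w ≠ 0 := by
    rintro rfl
    exact lt_irrefl _ hw
  have hξ : 0 < (-w⁻¹).re := by
    rw [Complex.neg_re, Complex.inv_re, neg_pos]
    exact div_neg_of_neg_of_pos hw (Complex.normSq_pos.2 hw0)
  have hpolar := laguerre_rightHalfPlane (natDegree_binomialPoly_le (d + 1) b) d.succ_ne_zero hb
    hz hξ
  contrapose! hpolar
  rw [binomialPoly_sub_mul, eval_sub, eval_mul, eval_C] at hpolar
  rw [derivative_binomialPoly_succ, binomialPoly_succ]
  simp only [eval_add, eval_mul, eval_C, eval_X, Nat.cast_add, Nat.cast_one]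
  field_simp
  linear_combination -(d + 1 : ℂ) * hpolar

lemma sum_mul_coeff_X_sub_C_mul {R : Type*} [CommRing R] {d : ℕ} {r : R[X]}
    (hr : r.natDegree ≤ d) (b : ℕ → R) (w : R) :
    ∑ j ∈ Finset.range (d + 2), b j * ((X - C w) * r).coeff j =
      ∑ j ∈ Finset.range (d + 1), (b (j + 1) - w * b j) * r.coeff j := by
  have htop : r.coeff (d + 1) = 0 := coeff_eq_zero_of_natDegree_lt (Nat.lt_succ_of_le hr)
  simp only [sub_mul, coeff_sub, coeff_C_mul, mul_sub, Finset.sum_sub_distrib]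
  congr 1
  · rw [Finset.sum_range_succ', coeff_X_mul_zero, mul_zero, add_zero]
    simp only [coeff_X_mul]
  · rw [Finset.sum_range_succ, htop, mul_zero, mul_zero, add_zero]
    exact Finset.sum_congr rfl fun j _ => by ring

/-- Each linear factor of `q` acts on `b` as a polar derivative, which preserves zero-freeness. -/
theorem grace_rightHalfPlane {d : ℕ} {b : ℕ → ℂ} {q : ℂ[X]}
    (hb : ∀ z : ℂ, 0 < z.re → (binomialPoly d b).eval z ≠ 0) (hqd : q.natDegree = d)
    (hq : ∀ z : ℂ, 0 ≤ z.re → q.eval z ≠ 0) :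
    ∑ j ∈ Finset.range (d + 1), b j * q.coeff j ≠ 0 := by
  induction d generalizing b q with
  | zero =>
    have hb0 := hb 1 (by simp)
    have hq0 := hq 0 le_rfl
    rw [← coeff_zero_eq_eval_zero] at hq0
    simpa [binomialPoly, hq0] using hb0
  | succ d ih =>
    obtain ⟨w, hw⟩ := IsAlgClosed.exists_root q (natDegree_pos_iff_degree_pos.1 (by omega)).ne'
    obtain ⟨r, rfl⟩ := dvd_iff_isRoot.2 hw
    have hw0 : w.re < 0 := by
      by_contra! h
      exact hq w h hw
    have hr0 : r ≠ 0 := by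
      rintro rfl
      simp at hqd
    have hrd : r.natDegree = d := by
      rw [natDegree_mul (X_sub_C_ne_zero w) hr0, natDegree_X_sub_C] at hqd
      omega
    rw [sum_mul_coeff_X_sub_C_mul hrd.le]
    refine ih (fun z hz => eval_binomialPoly_shift_ne_zero hb hw0 hz) hrd fun z hz => ?_
    exact right_ne_zero_of_mul (eval_mul (p := X - C w) (q := r) ▸ hq z hz)

end Grace

section Sector

variable {θ : ℝ} {z : ℂ}

lemma mem_sector_iff (hθ₀ : 0 ≤ θ) (hθ : θ ≤ Real.pi) :
    z ∈ sector θ ↔ ‖z‖ * Real.cos θ < z.re := by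
  rcases eq_or_ne z 0 with rfl | hz
  · simp [sector]
  · rw [← Complex.norm_mul_cos_arg z, mul_lt_mul_iff_right₀ (norm_pos_iff.2 hz),
      ← Real.cos_abs z.arg,
      Real.strictAntiOn_cos.lt_iff_gt ⟨hθ₀, hθ⟩ ⟨abs_nonneg _, Complex.abs_arg_le_pi z⟩]
    exact and_iff_right hz

lemma isOpen_sector (hθ : θ ≤ Real.pi) : IsOpen (sector θ) := by
  rcases lt_or_ge θ 0 with hneg | hθ₀
  · have hempty : sector θ = ∅ :=
      Set.eq_empty_of_forall_notMem fun z hz => (hz.2.trans hneg).not_ge (abs_nonneg _)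
    exact hempty ▸ isOpen_empty
  have hset : sector θ = {z : ℂ | ‖z‖ * Real.cos θ < z.re} :=
    Set.ext fun _ => mem_sector_iff hθ₀ hθ
  rw [hset]
  exact isOpen_lt (by fun_prop) (by fun_prop)

lemma ofReal_mem_sector (hθ : 0 < θ) {x : ℝ} (hx : 0 < x) : (x : ℂ) ∈ sector θ :=
  ⟨Complex.ofReal_ne_zero.2 hx.ne', by rwa [Complex.arg_ofReal_of_nonneg hx.le, abs_zero]⟩

lemma add_ofReal_mem_sector (hθ : θ ≤ Real.pi) (hz : z ∈ sector θ) {x : ℝ} (hx : 0 ≤ x) :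
    z + x ∈ sector θ := by
  have hθ₀ : 0 ≤ θ := (abs_nonneg _).trans hz.2.le
  rw [mem_sector_iff hθ₀ hθ] at hz ⊢
  have hvar : (‖z + x‖ - ‖z‖) * Real.cos θ ≤ x :=
    calc (‖z + x‖ - ‖z‖) * Real.cos θ
        ≤ |‖z + x‖ - ‖z‖| * |Real.cos θ| := (le_abs_self _).trans_eq (abs_mul _ _)
      _ ≤ ‖z + x - z‖ * 1 := by
        gcongr
        exacts [abs_norm_sub_norm_le _ _, Real.abs_cos_le_one θ]
      _ = x := by rw [add_sub_cancel_left, Complex.norm_of_nonneg hx, mul_one]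
  rw [Complex.add_re, Complex.ofReal_re]
  linarith

lemma mul_mem_sector {φ ψ : ℝ} {w : ℂ} (hz : z ∈ sector φ) (hw₀ : w ≠ 0) (hw : |w.arg| ≤ ψ) :
    z * w ∈ sector (φ + ψ) := by
  have hzw : z * w ≠ 0 := mul_ne_zero hz.1 hw₀
  refine ⟨hzw, ?_⟩
  calc |(z * w).arg| = InnerProductGeometry.angle 1 (z * w) := (Complex.angle_one_left hzw).symm
    _ ≤ InnerProductGeometry.angle 1 z + InnerProductGeometry.angle (z * 1) (z * w) := by
      rw [mul_one]
      exact InnerProductGeometry.angle_le_angle_add_angle 1 z (z * w)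
    _ = |z.arg| + |w.arg| := by
      rw [Complex.angle_mul_left hz.1, Complex.angle_one_left hz.1, Complex.angle_one_left hw₀]
    _ < φ + ψ := add_lt_add_of_lt_of_le hz.2 hw

lemma exists_sq_eq_of_mem_sector (hz : z ∈ sector θ) : ∃ s ∈ sector (θ / 2), s ^ 2 = z := by
  obtain ⟨hz₀, hz⟩ := hz
  have him : (Complex.log z / 2).im = z.arg / 2 := by
    rw [Complex.div_ofNat_im, Complex.log_im]
  have hmem : z.arg / 2 ∈ Set.Ioc (-Real.pi) Real.pi := by
    have hpi := Real.pi_pos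
    have hlt := Complex.neg_pi_lt_arg z
    have hle := Complex.arg_le_pi z
    constructor <;> linarith
  refine ⟨Complex.exp (Complex.log z / 2), ⟨Complex.exp_ne_zero _, ?_⟩, ?_⟩
  · rw [← him] at hmem
    rw [Complex.arg_exp, (toIocMod_eq_self _).2 (by simpa [two_mul] using hmem), him, abs_div,
      abs_two]
    linarith
  · rw [← Complex.exp_nat_mul, Nat.cast_ofNat, mul_div_cancel₀ _ two_ne_zero, Complex.exp_log hz₀]

lemma nonvanishing_of_eval_sq {σ : Type*} {F : MvPolynomial σ ℂ} {Q : ℂ[X]}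
    (hQ : ∀ s y : ℂ, s ^ 2 = y → Q.eval y = MvPolynomial.eval (fun _ => s) F)
    (hF : MvNonvanishing (sector (θ / 2)) F) : Nonvanishing (sector θ) Q := by
  rcases hF with rfl | hne
  · refine Or.inl (Polynomial.funext fun y => ?_)
    obtain ⟨s, hs⟩ := IsAlgClosed.exists_pow_nat_eq y two_pos
    rw [hQ s y hs, map_zero, eval_zero]
  · refine Or.inr fun y hy => ?_
    obtain ⟨s, hs, hsy⟩ := exists_sq_eq_of_mem_sector hy
    rw [hQ s y hsy]
    exact hne _ fun _ => hs

end Sector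

section Hurwitz

lemma norm_sub_le_mul_of_le_norm {r : ℝ} (hr : 0 < r) {a : ℂ} (ha : r ≤ ‖a‖) (t : ℂ) :
    ‖t - a‖ ≤ (1 + ‖t‖ / r) * ‖a‖ := by
  have hscale : ‖t‖ ≤ ‖t‖ / r * ‖a‖ := by
    rw [div_mul_eq_mul_div, le_div_iff₀ hr]
    gcongr
  linarith [norm_sub_le t a]

lemma norm_eval_le_of_ne_zero {q : ℂ[X]} {D : ℕ} (hD : q.natDegree ≤ D) {r : ℝ} (hr : 0 < r)
    (hq : ∀ t : ℂ, ‖t‖ < r → q.eval t ≠ 0) (t : ℂ) :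
    ‖q.eval t‖ ≤ (1 + ‖t‖ / r) ^ D * ‖q.eval 0‖ := by
  have hroot : ∀ a ∈ q.roots, r ≤ ‖a‖ := by
    intro a ha
    by_contra! har
    exact hq a har (isRoot_of_mem_roots ha)
  have hone : 1 ≤ 1 + ‖t‖ / r := le_add_of_nonneg_right (by positivity)
  have hsplit := IsAlgClosed.splits q
  have hprod (x : ℂ) : ‖q.eval x‖ = ‖q.leadingCoeff‖ * (q.roots.map fun a => ‖x - a‖).prod := by
    rw [hsplit.eval_eq_prod_roots, norm_mul]
    congr 1
    simpa using map_multiset_prod (normHom : ℂ →*₀ ℝ) (q.roots.map fun a => x - a)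
  have hcard : (q.roots.map fun _ => 1 + ‖t‖ / r).prod ≤ (1 + ‖t‖ / r) ^ D := by
    rw [Multiset.map_const', Multiset.prod_replicate]
    exact pow_le_pow_right₀ hone ((card_roots' q).trans hD)
  calc ‖q.eval t‖
      = ‖q.leadingCoeff‖ * (q.roots.map fun a => ‖t - a‖).prod := hprod t
    _ ≤ ‖q.leadingCoeff‖ * (q.roots.map fun a => (1 + ‖t‖ / r) * ‖a‖).prod := by
      gcongr
      exact Multiset.prod_map_le_prod_map₀ _ _ (fun _ _ => norm_nonneg _)
        fun a ha => norm_sub_le_mul_of_le_norm hr (hroot a ha) t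
    _ = (q.roots.map fun _ => 1 + ‖t‖ / r).prod * ‖q.eval 0‖ := by
      rw [hprod, Multiset.prod_map_mul]
      simp only [zero_sub, norm_neg]
      ring
    _ ≤ (1 + ‖t‖ / r) ^ D * ‖q.eval 0‖ := by gcongr

variable {σ : Type*} (z y : σ → ℂ) (F : MvPolynomial σ ℂ)

/-- The restriction `t ↦ F (z + t y)` of `F` to a complex line. -/
noncomputable def lineRestriction : ℂ[X] :=
  MvPolynomial.aeval (fun v => C (z v) + C (y v) * X) F

lemma eval_lineRestriction (t : ℂ) :
    (lineRestriction z y F).eval t = MvPolynomial.eval (fun v => z v + y v * t) F := by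
  refine (MvPolynomial.comp_aeval_apply _ (Polynomial.aeval t) F).trans ?_
  simp [MvPolynomial.aeval_eq_eval]

lemma natDegree_lineRestriction_le : (lineRestriction z y F).natDegree ≤ F.totalDegree := by
  simpa only [lineRestriction, mul_one] using MvPolynomial.aeval_natDegree_le F le_rfl
    (fun v => C (z v) + C (y v) * X) (n := 1) fun v => by compute_degree

variable {F}

theorem mvNonvanishing_of_tendsto [Finite σ] {ι : Type*} {l : Filter ι} [l.NeBot] {A : Set ℂ}
    (hA : IsOpen A) {Φ : ι → MvPolynomial σ ℂ} {D : ℕ} (hD : ∀ᶠ i in l, (Φ i).totalDegree ≤ D)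
    (hΦ : ∀ᶠ i in l, ∀ z : σ → ℂ, (∀ v, z v ∈ A) → MvPolynomial.eval z (Φ i) ≠ 0)
    (hlim : ∀ z : σ → ℂ,
      Tendsto (fun i => MvPolynomial.eval z (Φ i)) l (𝓝 (MvPolynomial.eval z F))) :
    MvNonvanishing A F := by
  refine or_iff_not_imp_right.2 fun hzero => MvPolynomial.funext fun w => ?_
  push Not at hzero
  obtain ⟨z, hzA, hz⟩ := hzero
  have hopen : IsOpen {t : ℂ | ∀ v, z v + (w v - z v) * t ∈ A} := by
    simp only [Set.ofPred_forall]
    exact isOpen_iInter_of_finite fun v => hA.preimage (by fun_prop)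
  obtain ⟨r, hr, hball⟩ := Metric.isOpen_iff.1 hopen 0 (by simpa using hzA)
  have hbound : ∀ᶠ i in l, ‖MvPolynomial.eval w (Φ i)‖ ≤
      (1 + ‖(1 : ℂ)‖ / r) ^ D * ‖MvPolynomial.eval z (Φ i)‖ := by
    filter_upwards [hD, hΦ] with i hDi hΦi
    have hline := norm_eval_le_of_ne_zero (q := lineRestriction z (w - z) (Φ i))
      ((natDegree_lineRestriction_le _ _ _).trans hDi) hr (fun t ht => by
        rw [eval_lineRestriction]
        exact hΦi _ (hball (mem_ball_zero_iff.2 ht))) 1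
    simpa [eval_lineRestriction] using hline
  have hle := le_of_tendsto_of_tendsto (hlim w).norm ((hlim z).norm.const_mul _) hbound
  rw [hz, norm_zero, mul_zero] at hle
  rw [map_zero, norm_le_zero_iff.1 hle]

end Hurwitz

section Szego

variable {θ : ℝ} {d : ℕ}

theorem szego_composition_ne_zero {p : ℂ[X]} {u : ℕ → ℂ} {z : ℂ}
    (hpd : p.natDegree ≤ d) (hp : ∀ t : ℂ, 0 < t.re → p.eval t ≠ 0)
    (hud : (binomialPoly d u).natDegree = d)
    (hu : ∀ w ∈ insert 0 (sector θ), (binomialPoly d u).eval w ≠ 0)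
    (hz : z ∈ sector (θ - Real.pi / 2)) :
    ∑ j ∈ Finset.range (d + 1), p.coeff j * u j * z ^ j ≠ 0 := by
  rw [← binomialPoly_coeff_div_choose hpd] at hp
  have hdeg : ((binomialPoly d u).comp (C z * X)).natDegree = d := by
    rw [natDegree_comp, hud, natDegree_C_mul_X z hz.1, mul_one]
  have hgrace := grace_rightHalfPlane hp hdeg fun t ht => by
    rw [eval_comp, eval_mul, eval_C, eval_X]
    rcases eq_or_ne t 0 with rfl | ht₀
    · exact hu _ (Or.inl (mul_zero z))
    · have hzt := mul_mem_sector hz ht₀ (Complex.abs_arg_le_pi_div_two_iff.2 ht)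
      rw [sub_add_cancel] at hzt
      exact hu _ (Or.inr hzt)
  convert! hgrace using 2 with j hj
  have hchoose : (d.choose j : ℂ) ≠ 0 :=
    Nat.cast_ne_zero.2 (Nat.choose_pos (Finset.mem_range_succ_iff.1 hj)).ne'
  rw [comp_C_mul_X_coeff, coeff_binomialPoly]
  field_simp

lemma eval_sum_C_mul_X_pow {ι : Type*} (s : Finset ι) (a : ι → ℂ) (n : ι → ℕ) (t : ℂ) :
    (∑ i ∈ s, C (a i) * X ^ n i).eval t = ∑ i ∈ s, a i * t ^ n i := by
  simp [eval_finsetSum]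

theorem szego_composition_sum_ne_zero {ι : Type*} {s : Finset ι} {a : ι → ℂ} {n : ι → ℕ}
    {u : ℕ → ℂ} {z : ℂ} (hn : ∀ i ∈ s, n i ≤ d)
    (ha : ∀ t : ℂ, 0 < t.re → ∑ i ∈ s, a i * t ^ n i ≠ 0)
    (hud : (binomialPoly d u).natDegree = d)
    (hu : ∀ w ∈ insert 0 (sector θ), (binomialPoly d u).eval w ≠ 0)
    (hz : z ∈ sector (θ - Real.pi / 2)) :
    ∑ i ∈ s, a i * u (n i) * z ^ n i ≠ 0 := by
  have hpd : (∑ i ∈ s, C (a i) * X ^ n i).natDegree ≤ d :=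
    natDegree_sum_le_of_forall_le _ _ fun i hi => (natDegree_C_mul_X_pow_le _ _).trans (hn i hi)
  have hszego := szego_composition_ne_zero hpd
    (fun t ht => by rw [eval_sum_C_mul_X_pow]; exact ha t ht) hud hu hz
  have hfiber : ∑ j ∈ Finset.range (d + 1), (∑ i ∈ s, C (a i) * X ^ n i).coeff j * u j * z ^ j =
      ∑ i ∈ s, a i * u (n i) * z ^ n i := by
    simp only [finsetSum_coeff, coeff_C_mul_X_pow, Finset.sum_mul]
    rw [Finset.sum_comm]
    refine Finset.sum_congr rfl fun i hi => ?_
    simp [ite_mul, Finset.mem_range_succ_iff.2 (hn i hi)]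
  rwa [← hfiber]

end Szego

section Perturbation

variable {θ ε : ℝ} {d : ℕ} {K : ℂ[X]}

/-- An approximation of `K` as `ε → 0`, of exact degree `d` and without zero at the origin: the
factor `(1 + ε X) ^ (d - deg K)` raises the degree and the translation moves the zeros of `K` by
`-ε`. -/
noncomputable def perturb (d : ℕ) (K : ℂ[X]) (ε : ℝ) : ℂ[X] :=
  (1 + C (ε : ℂ) * X) ^ (d - K.natDegree) * taylor (ε : ℂ) K

lemma eval_perturb (z : ℂ) :
    (perturb d K ε).eval z = (1 + ε * z) ^ (d - K.natDegree) * K.eval (z + ε) := by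
  simp [perturb, taylor_eval]

lemma natDegree_perturb (hd : K.natDegree ≤ d) (hK : K ≠ 0) (hε : ε ≠ 0) :
    (perturb d K ε).natDegree = d := by
  have hlin : (1 + C (ε : ℂ) * X).natDegree = 1 := by
    rw [add_comm, ← C_1, natDegree_linear (Complex.ofReal_ne_zero.2 hε)]
  have hlin₀ : (1 + C (ε : ℂ) * X) ≠ 0 := ne_zero_of_natDegree_gt (n := 0) (by omega)
  rw [perturb, natDegree_mul (pow_ne_zero _ hlin₀) (by simpa using hK), natDegree_pow,
    natDegree_taylor, hlin]
  omega

lemma eval_perturb_ne_zero (hθ₀ : 0 < θ) (hθ : θ ≤ Real.pi) (hK : ∀ z ∈ sector θ, K.eval z ≠ 0)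
    (hε : 0 < ε) {z : ℂ} (hz : z ∈ insert 0 (sector θ)) : (perturb d K ε).eval z ≠ 0 := by
  rw [eval_perturb]
  rcases hz with rfl | hz
  · simpa using hK ε (ofReal_mem_sector hθ₀ hε)
  · refine mul_ne_zero (pow_ne_zero _ ?_) (hK _ (add_ofReal_mem_sector hθ hz hε.le))
    have hmem := (add_ofReal_mem_sector hθ hz (inv_pos.2 hε).le).1
    contrapose! hmem
    push_cast
    field_simp [Complex.ofReal_ne_zero.2 hε.ne']
    linear_combination hmem

lemma tendsto_coeff_perturb (d : ℕ) (K : ℂ[X]) (j : ℕ) :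
    Tendsto (fun ε : ℝ => (perturb d K ε).coeff j) (𝓝 0) (𝓝 (K.coeff j)) := by
  have hcont : Continuous fun ε : ℝ => (perturb d K ε).coeff j := by
    have hlin (ε : ℝ) (i : ℕ) : ((1 + C (ε : ℂ) * X) ^ (d - K.natDegree)).coeff i =
        ((d - K.natDegree).choose i) * (ε : ℂ) ^ i := by
      have hcoeff := comp_C_mul_X_coeff (p := (1 + X : ℂ[X]) ^ (d - K.natDegree))
        (r := (ε : ℂ)) (n := i)
      simpa [coeff_one_add_X_pow] using hcoeff
    simp only [perturb, coeff_mul, hlin, taylor_coeff]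
    fun_prop
  simpa [perturb] using hcont.tendsto 0

theorem exists_tendsto_activities (hθ₀ : 0 < θ) (hθ : θ ≤ Real.pi) {u : ℕ → ℂ}
    (hu : ∀ z ∈ sector θ, (binomialPoly d u).eval z ≠ 0) :
    ∃ U : ℝ → ℕ → ℂ,
      (∀ ε > 0, (binomialPoly d (U ε)).natDegree = d ∧
        ∀ z ∈ insert 0 (sector θ), (binomialPoly d (U ε)).eval z ≠ 0) ∧
      ∀ j ≤ d, Tendsto (fun ε => U ε j) (𝓝[>] 0) (𝓝 (u j)) := by
  set K := binomialPoly d u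
  have hK₀ : K ≠ 0 := by
    intro h
    exact hu 1 (by simpa using ofReal_mem_sector hθ₀ one_pos) (by rw [h, eval_zero])
  refine ⟨fun ε j => (perturb d K ε).coeff j / d.choose j, fun ε hε => ?_, fun j hj => ?_⟩
  · have hdeg := natDegree_perturb (natDegree_binomialPoly_le d u) hK₀ hε.ne'
    rw [binomialPoly_coeff_div_choose hdeg.le]
    exact ⟨hdeg, fun z hz => eval_perturb_ne_zero hθ₀ hθ hu hε hz⟩
  · have hchoose : (d.choose j : ℂ) ≠ 0 := Nat.cast_ne_zero.2 (Nat.choose_pos hj).ne'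
    have hcoeff := ((tendsto_coeff_perturb d K j).div_const (d.choose j : ℂ)).mono_left
      (nhdsWithin_le_nhds (s := Set.Ioi 0))
    rwa [coeff_binomialPoly, mul_div_cancel_left₀ _ hchoose] at hcoeff

end Perturbation

section ActivityPoly

variable {σ ι : Type*} [Fintype σ] [Fintype ι]

/-- The polynomial `∑ i, c_i ∏ v, u_v(n_i(v)) x_v ^ n_i(v)`, in which the monomial `x_v ^ k` carries
the activity `u_v(k)`. The partition function `Z` is the case where `i` runs over the edge sets, `c`
is the product of the edge weights and `n` the degree. -/
noncomputable def activityPoly (c : ι → ℂ) (n : ι → σ → ℕ) (u : σ → ℕ → ℂ) : MvPolynomial σ ℂ :=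
  ∑ i, MvPolynomial.C (c i * ∏ v, u v (n i v)) * ∏ v, MvPolynomial.X v ^ n i v

variable (c : ι → ℂ) (n : ι → σ → ℕ) (u : σ → ℕ → ℂ)

lemma eval_activityPoly (x : σ → ℂ) :
    MvPolynomial.eval x (activityPoly c n u) =
      ∑ i, (c i * ∏ v, u v (n i v)) * ∏ v, x v ^ n i v := by
  simp [activityPoly]

lemma eval_activityPoly_update [DecidableEq σ] (x : σ → ℂ) (v : σ) (a : ℕ → ℂ) (z : ℂ) :
    MvPolynomial.eval (Function.update x v z) (activityPoly c n (Function.update u v a)) =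
      ∑ i, (c i * ∏ w ∈ Finset.univ.erase v, u w (n i w) * x w ^ n i w) * a (n i v) *
        z ^ n i v := by
  rw [eval_activityPoly]
  refine Finset.sum_congr rfl fun i _ => ?_
  have hrest : ∀ w ∈ Finset.univ.erase v,
      Function.update u v a w (n i w) * Function.update x v z w ^ n i w =
        u w (n i w) * x w ^ n i w := fun w hw => by
    rw [Function.update_of_ne (Finset.ne_of_mem_erase hw),
      Function.update_of_ne (Finset.ne_of_mem_erase hw)]
  rw [mul_assoc, ← Finset.prod_mul_distrib, ← Finset.mul_prod_erase _ _ (Finset.mem_univ v),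
    Finset.prod_congr rfl hrest, Function.update_self, Function.update_self]
  ring

variable {c n u}

lemma activityPoly_eq_zero {v : σ} (hv : ∀ i, u v (n i v) = 0) : activityPoly c n u = 0 := by
  refine Finset.sum_eq_zero fun i _ => ?_
  rw [Finset.prod_eq_zero (Finset.mem_univ v) (hv i), mul_zero, map_zero, zero_mul]

lemma totalDegree_activityPoly_le {d : σ → ℕ} (hn : ∀ i v, n i v ≤ d v) :
    (activityPoly c n u).totalDegree ≤ ∑ v, d v := by
  refine MvPolynomial.totalDegree_finsetSum_le fun i _ =>
    (MvPolynomial.totalDegree_mul _ _).trans ?_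
  rw [MvPolynomial.totalDegree_C, zero_add]
  refine (MvPolynomial.totalDegree_finsetProd _ _).trans (Finset.sum_le_sum fun v _ => ?_)
  rw [MvPolynomial.totalDegree_X_pow]
  exact hn i v

lemma tendsto_eval_activityPoly {κ : Type*} {l : Filter κ} {U : κ → σ → ℕ → ℂ} {d : σ → ℕ}
    (hn : ∀ i v, n i v ≤ d v) (hU : ∀ v, ∀ j ≤ d v, Tendsto (fun k => U k v j) l (𝓝 (u v j)))
    (x : σ → ℂ) :
    Tendsto (fun k => MvPolynomial.eval x (activityPoly c n (U k))) l
      (𝓝 (MvPolynomial.eval x (activityPoly c n u))) := by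
  simp only [eval_activityPoly]
  exact tendsto_finsetSum _ fun i _ => ((tendsto_finsetProd _ fun v _ =>
    hU v _ (hn i v)).const_mul _).mul_const _

variable {θ : ℝ}

lemma eval_activityPoly_ne_zero_of_mem {d : σ → ℕ} (hn : ∀ i v, n i v ≤ d v)
    (hone : ∀ x : σ → ℂ, (∀ v, 0 < (x v).re) → MvPolynomial.eval x (activityPoly c n 1) ≠ 0)
    (hud : ∀ v, (binomialPoly (d v) (u v)).natDegree = d v)
    (hu : ∀ v, ∀ w ∈ insert 0 (sector θ), (binomialPoly (d v) (u v)).eval w ≠ 0)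
    [DecidableEq σ] {W : Finset σ} {x : σ → ℂ} (hxW : ∀ v ∈ W, x v ∈ sector (θ - Real.pi / 2))
    (hx : ∀ v ∉ W, 0 < (x v).re) :
    MvPolynomial.eval x (activityPoly c n (W.piecewise u 1)) ≠ 0 := by
  induction W using Finset.induction_on generalizing x with
  | empty => simpa using hone x (by simpa using hx)
  | insert v W hv ih =>
    rw [Finset.forall_mem_insert] at hxW
    rw [Finset.piecewise_insert, ← Function.update_eq_self v x, eval_activityPoly_update]
    refine szego_composition_sum_ne_zero (fun i _ => hn i v) (fun t ht => ?_) (hud v) (hu v) hxW.1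
    have hupdate := ih (x := Function.update x v t) (fun w hw => ?_) (fun w hw => ?_)
    · rw [← Function.update_eq_self v (W.piecewise u 1), eval_activityPoly_update] at hupdate
      simpa [hv] using hupdate
    · rw [Function.update_of_ne (ne_of_mem_of_not_mem hw hv)]
      exact hxW.2 w hw
    · rcases eq_or_ne w v with rfl | hwv
      · rwa [Function.update_self]
      · rw [Function.update_of_ne hwv]
        exact hx w (by simp [hwv, hw])

/-- The key polynomials are perturbed so that Szegő's composition theorem applies to them, one
variable at a time; zero-freeness survives the limit. -/
theorem mvNonvanishing_activityPoly (hθ₀ : 0 < θ) (hθ : θ ≤ Real.pi) {d : σ → ℕ}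
    (hn : ∀ i v, n i v ≤ d v)
    (hone : ∀ x : σ → ℂ, (∀ v, 0 < (x v).re) → MvPolynomial.eval x (activityPoly c n 1) ≠ 0)
    (hu : ∀ v, Nonvanishing (sector θ) (binomialPoly (d v) (u v))) :
    MvNonvanishing (sector (θ - Real.pi / 2)) (activityPoly c n u) := by
  classical
  by_cases hzero : ∃ v, binomialPoly (d v) (u v) = 0
  · obtain ⟨v, hv⟩ := hzero
    exact Or.inl (activityPoly_eq_zero fun i => binomialPoly_eq_zero_iff.1 hv _ (hn i v))
  push Not at hzero
  choose U hU hlim using fun v =>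
    exists_tendsto_activities hθ₀ hθ ((hu v).resolve_left (hzero v))
  refine mvNonvanishing_of_tendsto (l := 𝓝[>] 0) (isOpen_sector (by linarith [Real.pi_pos]))
    (Eventually.of_forall fun ε => totalDegree_activityPoly_le hn)
    (eventually_nhdsWithin_of_forall fun ε hε x hx => ?_)
    (tendsto_eval_activityPoly (U := fun ε v => U v ε) hn hlim)
  simpa using eval_activityPoly_ne_zero_of_mem (W := Finset.univ) hn hone
    (fun v => (hU v ε hε).1) (fun v => (hU v ε hε).2) (fun v _ => hx v) (by simp)

end ActivityPoly

section IntervalActivities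

/-- If `a + b z + c z ^ 2 = 0` with `z` not real then `a = c ‖z‖ ^ 2` and `b = -2 c z.re`. -/
lemma quadratic_ne_zero_of_mem_sector {a b c θ : ℝ} (ha : 0 < a) (hb : 0 ≤ b) (hc : 0 ≤ c)
    (hθ : θ ≤ Real.pi) (hdisc : 4 * a * c * Real.cos θ ^ 2 ≤ b ^ 2) {z : ℂ} (hz : z ∈ sector θ) :
    (a + b * z + c * z ^ 2 : ℂ) ≠ 0 := by
  intro h
  have hz' := (mem_sector_iff ((abs_nonneg _).trans hz.2.le) hθ).1 hz
  have hre : a + b * z.re + c * (z.re ^ 2 - z.im ^ 2) = 0 := by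
    simpa [sq] using congrArg Complex.re h
  have him : z.im * (b + 2 * c * z.re) = 0 := by
    have him_eq := congrArg Complex.im h
    simp only [sq, Complex.add_im, Complex.ofReal_im, Complex.mul_im, Complex.ofReal_re, zero_mul,
      add_zero, zero_add, Complex.mul_re, Complex.zero_im] at him_eq
    linear_combination him_eq
  rcases mul_eq_zero.1 him with him₀ | hb_eq
  · have hpos : 0 < z.re := by
      have harg : z.arg ≠ Real.pi := fun h => ((le_abs_self _).trans_lt hz.2).not_ge (h ▸ hθ)
      exact (Complex.mem_slitPlane_iff_arg.2 ⟨harg, hz.1⟩).resolve_right (not_not.2 him₀)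
    rw [him₀] at hre
    have hnonneg : 0 ≤ b * z.re + c * z.re ^ 2 := by positivity
    linarith
  · have ha_eq : a = c * ‖z‖ ^ 2 := by
      rw [← Complex.normSq_eq_norm_sq, Complex.normSq_apply]
      linear_combination hre - z.re * hb_eq
    have hc₀ : 0 < c := by
      by_contra!
      nlinarith [sq_nonneg ‖z‖]
    have hre₀ : z.re ≤ 0 := by nlinarith
    have hsq : (‖z‖ * Real.cos θ) ^ 2 ≤ z.re ^ 2 := by
      rw [ha_eq, eq_neg_of_add_eq_zero_left hb_eq] at hdisc
      refine le_of_mul_le_mul_left ?_ (by positivity : 0 < 4 * c ^ 2)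
      linear_combination hdisc
    nlinarith

lemma choose_mul_choose_add_two_le (n k : ℕ) :
    n.choose k * n.choose (k + 2) ≤ n.choose (k + 1) ^ 2 := by
  rcases le_or_gt n k with h | h
  · simp [Nat.choose_eq_zero_of_lt (show n < k + 2 by omega)]
  have hup := Nat.choose_succ_right_eq n k
  have hdown := Nat.choose_succ_right_eq n (k + 1)
  refine le_of_mul_le_mul_left ?_ (by positivity [Nat.sub_pos_of_lt h] : 0 < (k + 2) * (n - k))
  calc (k + 2) * (n - k) * (n.choose k * n.choose (k + 2))
      = (n.choose k * (n - k)) * (n.choose (k + 2) * (k + 2)) := by ring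
    _ = (k + 1) * (n - (k + 1)) * n.choose (k + 1) ^ 2 := by rw [← hup, hdown]; ring
    _ ≤ (k + 2) * (n - k) * n.choose (k + 1) ^ 2 := by gcongr <;> omega

variable {V : Type*} {f g : V → ℕ} {v : V}

lemma binomialPoly_intervalActivity (d : ℕ) (hfg : f v ≤ g v) (hgf : g v ≤ f v + 2) :
    binomialPoly d (intervalActivity f g v) =
      X ^ f v * (C (d.choose (f v) : ℂ) +
        C ((if f v + 1 ≤ g v then d.choose (f v + 1) else 0 : ℕ) : ℂ) * X +
        C ((if f v + 2 ≤ g v then d.choose (f v + 2) else 0 : ℕ) : ℂ) * X ^ 2) := by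
  ext j
  rw [coeff_binomialPoly, coeff_X_pow_mul', intervalActivity]
  rcases lt_or_ge j (f v) with hj | hj
  · rw [if_neg (by omega), if_neg (by omega), mul_zero]
  · obtain ⟨i, rfl⟩ := Nat.exists_eq_add_of_le hj
    rw [if_pos hj, Nat.add_sub_cancel_left]
    match i with
    | 0 => simp [hfg]
    | 1 => simp [coeff_C]
    | 2 => simp
    | i + 3 => simp [show ¬ f v + (i + 3) ≤ g v by omega]

lemma nonvanishing_binomialPoly_intervalActivity (d : ℕ) (hgf : g v ≤ f v + 2) :
    Nonvanishing (sector (2 * Real.pi / 3)) (binomialPoly d (intervalActivity f g v)) := by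
  by_cases hempty : d < f v ∨ g v < f v
  · refine Or.inl (binomialPoly_eq_zero_iff.2 fun j hj => if_neg ?_)
    omega
  refine Or.inr fun z hz => ?_
  push Not at hempty
  obtain ⟨hfd, hfg⟩ := hempty
  have hcos : Real.cos (2 * Real.pi / 3) = -(1 / 2) := by
    rw [← Real.cos_pi_div_three, ← Real.cos_pi_sub]
    ring_nf
  rw [binomialPoly_intervalActivity d hfg hgf, eval_mul, eval_pow, eval_X]
  refine mul_ne_zero (pow_ne_zero _ hz.1) ?_
  set b : ℕ := if f v + 1 ≤ g v then d.choose (f v + 1) else 0 with hb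
  set c : ℕ := if f v + 2 ≤ g v then d.choose (f v + 2) else 0 with hc
  have hlogConcave : d.choose (f v) * c ≤ b ^ 2 := by
    rw [hb, hc]
    split_ifs
    · exact choose_mul_choose_add_two_le d (f v)
    · omega
    all_goals simp
  have hdisc : 4 * (d.choose (f v) : ℝ) * c * Real.cos (2 * Real.pi / 3) ^ 2 ≤ (b : ℝ) ^ 2 := by
    rw [hcos]
    calc 4 * (d.choose (f v) : ℝ) * c * (-(1 / 2)) ^ 2 = d.choose (f v) * c := by ring
      _ ≤ (b : ℝ) ^ 2 := by exact_mod_cast hlogConcave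
  have hquad := quadratic_ne_zero_of_mem_sector (Nat.cast_pos.2 (Nat.choose_pos hfd))
    b.cast_nonneg c.cast_nonneg (by linarith [Real.pi_pos]) hdisc hz
  simpa only [eval_add, eval_mul, eval_C, eval_X, eval_pow, Complex.ofReal_natCast] using hquad

end IntervalActivities

section PartitionFunction

lemma one_add_mul_mul_ne_zero {l : ℝ} (hl : 0 ≤ l) {z w : ℂ} (hz : 0 < z.re) (hw : 0 < w.re) :
    1 + (l : ℂ) * (z * w) ≠ 0 := by
  have hw₀ : w ≠ 0 := by
    rintro rfl
    exact lt_irrefl _ hw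
  have hre : 0 < (w⁻¹ + l * z).re := by
    have hinv : 0 < (w⁻¹).re := by
      rw [Complex.inv_re]
      exact div_pos hw (Complex.normSq_pos.2 hw₀)
    rw [Complex.add_re, Complex.re_ofReal_mul]
    positivity
  have hfactor : 1 + (l : ℂ) * (z * w) = w * (w⁻¹ + l * z) := by
    rw [mul_add, mul_inv_cancel₀ hw₀]
    ring
  rw [hfactor]
  exact mul_ne_zero hw₀ fun h => hre.ne' (by rw [h, Complex.zero_re])

variable {α β : Type*} (G : Graph α β)

open Classical in
lemma deg_eq_sum_ite (H : Finset E(G)) (v : V(G)) :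
    deg G H v = ∑ e ∈ H, ((if G.Inc e v then 1 else 0) + (if G.IsLoopAt e v then 1 else 0)) := by
  -- The filters in `deg` range over the image of `H` in `β`, inserted as a monadic lift.
  have himage : (do let e ← H; pure (e : β)) = H.map (Function.Embedding.subtype _) := by
    ext
    simp [Finset.bind_def, Finset.pure_def]
  rw [deg, himage]
  simp only [Finset.card_filter, Finset.sum_map, Finset.sum_add_distrib]
  rfl

lemma deg_eq_sum (H : Finset E(G)) (v : V(G)) : deg G H v = ∑ e ∈ H, deg G {e} v := by
  simp only [deg_eq_sum_ite, Finset.sum_singleton]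

lemma deg_mono {H H' : Finset E(G)} (h : H ⊆ H') (v : V(G)) : deg G H v ≤ deg G H' v := by
  rw [deg_eq_sum, deg_eq_sum G H']
  exact Finset.sum_le_sum_of_subset h

open Classical in
lemma exists_deg_singleton_eq (e : E(G)) :
    ∃ a b : V(G), ∀ v, deg G {e} v = (if v = a then 1 else 0) + (if v = b then 1 else 0) := by
  obtain ⟨a, b, hab⟩ := G.exists_isLink_of_mem_edgeSet e.2
  refine ⟨⟨a, hab.left_mem⟩, ⟨b, hab.right_mem⟩, fun v => ?_⟩
  have hinc : G.Inc e v ↔ (v : α) = a ∨ (v : α) = b := by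
    refine ⟨fun h => h.eq_or_eq_of_isLink hab, ?_⟩
    rintro (h | h) <;> rw [h]
    exacts [hab.inc_left, hab.inc_right]
  have hloop : G.IsLoopAt e v ↔ (v : α) = a ∧ (v : α) = b := by
    rw [← Graph.isLink_self_iff, hab.isLink_iff]
    grind
  simp only [deg_eq_sum_ite, Finset.sum_singleton, hinc, hloop, Subtype.ext_iff]
  split_ifs <;> simp_all

lemma exists_prod_pow_deg_singleton [Fintype V(G)] (e : E(G)) :
    ∃ a b : V(G), ∀ x : V(G) → ℂ, ∏ v, x v ^ deg G {e} v = x a * x b := by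
  classical
  obtain ⟨a, b, hdeg⟩ := exists_deg_singleton_eq G e
  refine ⟨a, b, fun x => ?_⟩
  simp only [hdeg, pow_add, Finset.prod_mul_distrib, pow_ite, pow_one, pow_zero]
  simp

lemma sum_deg_eq_two_mul_card [Fintype V(G)] (H : Finset E(G)) :
    ∑ v, deg G H v = 2 * H.card := by
  classical
  simp only [deg_eq_sum G H]
  rw [Finset.sum_comm, Finset.sum_const_nat (m := 2), mul_comm]
  intro e _
  obtain ⟨a, b, hdeg⟩ := exists_deg_singleton_eq G e
  simp [hdeg, Finset.sum_add_distrib]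

variable [Fintype E(G)]

lemma deg_le_degG (H : Finset E(G)) (v : V(G)) : deg G H v ≤ degG G v :=
  deg_mono G (Finset.subset_univ H) v

variable [Fintype V(G)]

lemma Z_eq_activityPoly (lam : E(G) → ℂ) (u : V(G) → ℕ → ℂ) :
    Z G lam u = activityPoly (fun H => ∏ e ∈ H, lam e) (deg G) u := rfl

lemma eval_Z_one (lam : E(G) → ℂ) (x : V(G) → ℂ) :
    MvPolynomial.eval x (Z G lam 1) = ∏ e, (1 + lam e * ∏ v, x v ^ deg G {e} v) := by
  rw [Z_eq_activityPoly, eval_activityPoly, Finset.prod_one_add, Finset.powerset_univ]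
  refine Finset.sum_congr rfl fun H _ => ?_
  simp only [Pi.one_apply, Finset.prod_const_one, mul_one, Finset.prod_mul_distrib]
  rw [Finset.prod_comm]
  simp only [Finset.prod_pow_eq_pow_sum, ← deg_eq_sum]

lemma eval_Z_one_ne_zero {lam : E(G) → ℝ} (hlam : ∀ e, 0 ≤ lam e) {x : V(G) → ℂ}
    (hx : ∀ v, 0 < (x v).re) : MvPolynomial.eval x (Z G (fun e => (lam e : ℂ)) 1) ≠ 0 := by
  rw [eval_Z_one, Finset.prod_ne_zero_iff]
  intro e _
  obtain ⟨a, b, hab⟩ := exists_prod_pow_deg_singleton G e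
  rw [hab]
  exact one_add_mul_mul_ne_zero (hlam e) (hx a) (hx b)

theorem mvNonvanishing_Z_of_key {θ : ℝ} (hθ₀ : 0 < θ) (hθ : θ ≤ Real.pi) {lam : E(G) → ℝ}
    (hlam : ∀ e, 0 ≤ lam e) {u : V(G) → ℕ → ℂ}
    (hkey : ∀ v, Nonvanishing (sector θ) (key G u v)) :
    MvNonvanishing (sector (θ - Real.pi / 2)) (Z G (fun e => (lam e : ℂ)) u) :=
  mvNonvanishing_activityPoly hθ₀ hθ (deg_le_degG G) (fun _ hx => eval_Z_one_ne_zero G hlam hx) hkey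

lemma exists_polynomial_eval_sq (lam : E(G) → ℂ) (u : V(G) → ℕ → ℂ) :
    ∃ Q : ℂ[X], ∀ s y : ℂ, s ^ 2 = y → Q.eval y = MvPolynomial.eval (fun _ => s) (Z G lam u) := by
  refine ⟨∑ H : Finset E(G), C ((∏ e ∈ H, lam e) * ∏ v, u v (deg G H v)) * X ^ H.card, ?_⟩
  rintro s _ rfl
  rw [eval_sum_C_mul_X_pow, Z_eq_activityPoly, eval_activityPoly]
  simp only [Finset.prod_pow_eq_pow_sum, sum_deg_eq_two_mul_card, pow_mul]

end PartitionFunction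

end HeilmannLieb

theorem mainTheorem6 {α β : Type*} (G : Graph α β) [Fintype V(G)] [Fintype E(G)]
    (lam : E(G) → ℝ) (hlam : ∀ e, 0 ≤ lam e)
    (f g : V(G) → ℕ) (hfg : ∀ v, f v ≤ g v) (hgf : ∀ v, g v ≤ f v + 2) :
    (∀ v : V(G), HeilmannLieb.Nonvanishing (HeilmannLieb.sector (2 * Real.pi / 3))
      (HeilmannLieb.key G (HeilmannLieb.intervalActivity f g) v)) ∧
    HeilmannLieb.MvNonvanishing (HeilmannLieb.sector (Real.pi / 6))
      (HeilmannLieb.Z G (fun e => (lam e : ℂ)) (HeilmannLieb.intervalActivity f g)) ∧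
    -- `Q(y) = Z(G, λ, u; y^{1/2} 1)`, for either choice `s` of the square root of `y`
    ∃ Q : Polynomial ℂ,
      (∀ s y : ℂ, s ^ 2 = y → Q.eval y = MvPolynomial.eval (fun _ => s)
        (HeilmannLieb.Z G (fun e => (lam e : ℂ)) (HeilmannLieb.intervalActivity f g))) ∧
      HeilmannLieb.Nonvanishing (HeilmannLieb.sector (Real.pi / 3)) Q := by
  have hkey : ∀ v : V(G), HeilmannLieb.Nonvanishing (HeilmannLieb.sector (2 * Real.pi / 3))
      (HeilmannLieb.key G (HeilmannLieb.intervalActivity f g) v) := fun v =>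
    HeilmannLieb.nonvanishing_binomialPoly_intervalActivity (HeilmannLieb.degG G v) (hgf v)
  have hZ := HeilmannLieb.mvNonvanishing_Z_of_key G (by positivity) (by linarith [Real.pi_pos])
    hlam hkey
  rw [show 2 * Real.pi / 3 - Real.pi / 2 = Real.pi / 6 by ring] at hZ
  obtain ⟨Q, hQ⟩ := HeilmannLieb.exists_polynomial_eval_sq G (fun e => (lam e : ℂ))
    (HeilmannLieb.intervalActivity f g)
  refine ⟨hkey, hZ, Q, hQ, HeilmannLieb.nonvanishing_of_eval_sq hQ ?_⟩
  rwa [show Real.pi / 3 / 2 = Real.pi / 6 by ring]
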